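/- **Theorem 4.6.** Let $\mathscr C$ be a semi-abelian category, i.e. a pointed, Barr-exact, Bourn-protomodular category with finite coproducts. A *split extension* of $B$ with kernel $X$ is a diagram $E=(A,B,X,\alpha,\beta,\kappa)$ with $\alpha:A\to B$, $\beta:B\to A$, $\kappa:X\to A$ such that $\alpha\beta=1_B$ and $\kappa$ is a kernel of $\alpha$. A morphism $(f,g,h):E\to E'$ consists of $f:A\to A'$, $g:B\to B'$, $h:X\to X'$ with $f\kappa=\kappa' h$, $\alpha' f=g\alpha$ and $f\beta=\beta' g$. For $X\in\mathscr C$ let $\mathrm{SplExt}(-,X):\mathscr C^{\mathrm{op}}\to\mathsf{Sets}$ be the functor sending $B$ to the set of isomorphism classes (with $B$ and $X$ fixed) of split extensions of $B$ with kernel $X$, and acting on morphisms by pullback. Call $\mathscr C$ * *weakly action representable* if for every object $X$ there are an object $M$ and a monomorphism of functors $\mathrm{SplExt}(-,X)\to\hom(-,M)$; * *action accessible* if for every object $X$, every split extension $E$ with kernel $X$ admits a morphism $(f,g,1_X):E\to E'$ to a faithful split extension $E'$ with kernel $X$, where $E'$ is *faithful* if every split extension $E''$ with kernel $X$ admits at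 most one morphism of the form $(f,g,1_X):E''\to E'$. If $\mathscr C$ is weakly action representable, then $\mathscr C$ is action accessible. Moreover (application), for every commutative unital ring $K$, the category $\mathsf{Alg}(K)$ of associative, not necessarily unital $K$-algebras is weakly action representable and is action accessible; for $K=\mathbb Z$ this is the category of not necessarily unital rings. -/

import Mathlib

open CategoryTheory CategoryTheory.Limits

universe w v u

/-! ### Split extensions -/

section SplitExtensions

variable {C : Type u} [Category.{v} C] [HasZeroMorphisms C]

/-- A split extension of `B` with kernel `X`: a diagram `X ⟶ A ⇄ B` in which `β` is a section
of `α` and `κ` is a kernel of `α`. -/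
structure SplitExtension (B X : C) where
  A : C
  α : A ⟶ B
  β : B ⟶ A
  κ : X ⟶ A
  section_proj : β ≫ α = 𝟙 B
  incl_proj : κ ≫ α = 0
  isKernel : Nonempty (IsLimit (KernelFork.ofι κ incl_proj))

namespace SplitExtension

/-- A morphism `(f, g, h)` of split extensions; `h` is the component on the kernels. -/
@[ext]
structure Hom {B X B' X' : C} (E : SplitExtension B X) (E' : SplitExtension B' X') where
  f : E.A ⟶ E'.A
  g : B ⟶ B'
  h : X ⟶ X'
  comm_κ : E.κ ≫ f = h ≫ E'.κ
  comm_α : f ≫ E'.α = E.α ≫ g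
  comm_β : E.β ≫ f = g ≫ E'.β

/-- Two split extensions of `B` with kernel `X` are isomorphic if there is an isomorphism
between them that is the identity on `B` and on `X`. -/
def Isom {B X : C} (E E' : SplitExtension B X) : Prop :=
  ∃ φ : Hom E E', φ.g = 𝟙 B ∧ φ.h = 𝟙 X ∧ IsIso φ.f

theorem isom_equivalence (B X : C) : Equivalence (Isom (B := B) (X := X)) where
  refl E := ⟨⟨𝟙 _, 𝟙 _, 𝟙 _, by simp, by simp, by simp⟩, rfl, rfl, inferInstance⟩
  symm := by
    rintro E E' ⟨⟨f, g, h, hκ, hα, hβ⟩, rfl, rfl, hf⟩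
    dsimp only at hf hκ hα hβ
    refine ⟨⟨inv f, 𝟙 _, 𝟙 _, ?_, ?_, ?_⟩, rfl, rfl, ?_⟩
    · rw [IsIso.comp_inv_eq, Category.id_comp, hκ, Category.id_comp]
    · rw [IsIso.inv_comp_eq, Category.comp_id, hα, Category.comp_id]
    · rw [IsIso.comp_inv_eq, Category.id_comp, hβ, Category.id_comp]
    · dsimp only; infer_instance
  trans := by
    rintro E E' E'' ⟨⟨f, g, h, hκ, hα, hβ⟩, rfl, rfl, hf⟩ ⟨⟨f', g', h', hκ', hα', hβ'⟩, rfl, rfl, hf'⟩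
    dsimp only at *
    refine ⟨⟨f ≫ f', 𝟙 _, 𝟙 _, ?_, ?_, ?_⟩, rfl, rfl, ?_⟩
    · rw [← Category.assoc, hκ, Category.id_comp, hκ']
    · rw [Category.assoc, hα', Category.comp_id, hα]
    · rw [← Category.assoc, hβ, Category.id_comp, hβ']
    · dsimp only; infer_instance

/-- Isomorphism of split extensions with fixed `B` and `X`. -/
instance isomSetoid (B X : C) : Setoid (SplitExtension B X) := ⟨Isom, isom_equivalence B X⟩

/-- `E'` is faithful if every split extension with the same kernel `X` has at most one morphism
into `E'` that is the identity on `X`. -/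
def IsFaithful {B' X : C} (E' : SplitExtension B' X) : Prop :=
  ∀ ⦃B : C⦄ (E : SplitExtension B X) (φ ψ : Hom E E'), φ.h = 𝟙 X → ψ.h = 𝟙 X → φ = ψ

section BaseChange

variable [HasPullbacks C]

/-- The pullback of a split extension of `B` along a morphism `g : B' ⟶ B`. -/
noncomputable def baseChange {B B' X : C} (g : B' ⟶ B) (E : SplitExtension B X) :
    SplitExtension B' X where
  A := pullback E.α g
  α := pullback.snd E.α g
  β := pullback.lift (g ≫ E.β) (𝟙 B') (by simp [E.section_proj])
  κ := pullback.lift E.κ 0 (by simp [E.incl_proj])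
  section_proj := pullback.lift_snd _ _ _
  incl_proj := pullback.lift_snd _ _ _
  isKernel := by
    obtain ⟨hE⟩ := E.isKernel
    have key : ∀ {W : C} (k : W ⟶ pullback E.α g), k ≫ pullback.snd E.α g = 0 →
        (k ≫ pullback.fst E.α g) ≫ E.α = 0 := fun k hk => by
      rw [Category.assoc, pullback.condition, reassoc_of% hk, zero_comp]
    have fac : ∀ {W : C} (k : W ⟶ pullback E.α g) (hk : k ≫ pullback.snd E.α g = 0),
        hE.lift (KernelFork.ofι (k ≫ pullback.fst E.α g) (key k hk)) ≫ E.κ =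
          k ≫ pullback.fst E.α g :=
      fun k hk => hE.fac (KernelFork.ofι _ (key k hk)) WalkingParallelPair.zero
    refine ⟨KernelFork.IsLimit.ofι _ _
      (fun k hk => hE.lift (KernelFork.ofι (k ≫ pullback.fst E.α g) (key k hk))) ?_ ?_⟩
    · intro W k hk
      apply pullback.hom_ext
      · rw [Category.assoc, pullback.lift_fst, fac k hk]
      · rw [Category.assoc, pullback.lift_snd, comp_zero, hk]
    · intro W k hk m hm
      refine Fork.IsLimit.hom_ext hE ?_
      refine Eq.trans ?_ (fac k hk).symm
      rw [← hm, Category.assoc, pullback.lift_fst]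
      rfl

/-- The projection from the pullback of a split extension. -/
noncomputable def baseChangeFst {B B' X : C} (g : B' ⟶ B) (E : SplitExtension B X) :
    (baseChange g E).A ⟶ E.A :=
  pullback.fst E.α g

theorem baseChange_isPullback {B B' X : C} (g : B' ⟶ B) (E : SplitExtension B X) :
    IsPullback (baseChangeFst g E) (baseChange g E).α E.α g :=
  IsPullback.of_hasPullback E.α g

theorem baseChange_κ_fst {B B' X : C} (g : B' ⟶ B) (E : SplitExtension B X) :
    (baseChange g E).κ ≫ baseChangeFst g E = E.κ :=
  pullback.lift_fst _ _ _

theorem baseChange_β_fst {B B' X : C} (g : B' ⟶ B) (E : SplitExtension B X) :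
    (baseChange g E).β ≫ baseChangeFst g E = g ≫ E.β :=
  pullback.lift_fst _ _ _

/-- A split extension with a pullback projection to `E` over `g`, compatible with the sections and
the kernels, is isomorphic to the pullback of `E` along `g`. -/
theorem isom_baseChange {B B' X : C} (g : B' ⟶ B) (E : SplitExtension B X)
    (E' : SplitExtension B' X) (p : E'.A ⟶ E.A) (hp : IsPullback p E'.α E.α g)
    (hκ : E'.κ ≫ p = E.κ) (hβ : E'.β ≫ p = g ≫ E.β) : Isom E' (baseChange g E) := by
  have hq := baseChange_isPullback g E
  refine ⟨⟨hq.lift p E'.α hp.w, 𝟙 _, 𝟙 _, hq.hom_ext ?_ ?_, ?_, hq.hom_ext ?_ ?_⟩, rfl, rfl,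
    hp.lift (baseChangeFst g E) (baseChange g E).α hq.w, hp.hom_ext ?_ ?_, hq.hom_ext ?_ ?_⟩
  · simp [hκ, baseChange_κ_fst]
  · simp [E'.incl_proj, (baseChange g E).incl_proj]
  · simp
  · simp [hβ, baseChange_β_fst]
  · simp [E'.section_proj, (baseChange g E).section_proj]
  all_goals simp

theorem baseChange_isom {B B' X : C} (g : B' ⟶ B) {E E' : SplitExtension B X} (h : Isom E E') :
    Isom (baseChange g E) (baseChange g E') := by
  obtain ⟨⟨f, g', h, hκ, hα, hβ⟩, rfl, rfl, hf⟩ := h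
  dsimp only at *
  refine isom_baseChange g E' _ (baseChangeFst g E ≫ f) ?_ ?_ ?_
  · have h2 : IsPullback f E.α E'.α (𝟙 B) := IsPullback.of_horiz_isIso ⟨hα⟩
    simpa using (baseChange_isPullback g E).flip.paste_vert h2.flip |>.flip
  · rw [← Category.assoc, baseChange_κ_fst, hκ, Category.id_comp]
  · rw [← Category.assoc, baseChange_β_fst, Category.assoc, hβ, Category.id_comp]

theorem baseChange_id_isom {B X : C} (E : SplitExtension B X) : Isom (baseChange (𝟙 B) E) E :=
  (isom_equivalence B X).symm <| isom_baseChange (𝟙 B) E E (𝟙 _)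
    (IsPullback.of_horiz_isIso ⟨by simp⟩) (by simp) (by simp)

theorem baseChange_comp_isom {B B' B'' X : C} (g : B' ⟶ B) (g' : B'' ⟶ B')
    (E : SplitExtension B X) :
    Isom (baseChange (g' ≫ g) E) (baseChange g' (baseChange g E)) := by
  refine (isom_equivalence _ X).symm <| isom_baseChange (g' ≫ g) E _
    (baseChangeFst g' (baseChange g E) ≫ baseChangeFst g E)
    ((baseChange_isPullback g' _).paste_horiz (baseChange_isPullback g E)) ?_ ?_
  · rw [← Category.assoc, baseChange_κ_fst, baseChange_κ_fst]
  · rw [← Category.assoc, baseChange_β_fst, Category.assoc, baseChange_β_fst, Category.assoc]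

end BaseChange

end SplitExtension

/-- `SplExt(B, X)`: isomorphism classes of split extensions of `B` with kernel `X`. -/
def SplExt (B X : C) : Type (max u v) := Quotient (SplitExtension.isomSetoid B X)

section Representability

variable [HasPullbacks C]

/-- The functor `SplExt(-, X) : Cᵒᵖ ⥤ Type`, acting on morphisms by pullback. -/
noncomputable def splExtFunctor (X : C) : Cᵒᵖ ⥤ Type (max u v) where
  obj B := SplExt B.unop X
  map g := ↾(Quotient.map (SplitExtension.baseChange g.unop)
    (fun _ _ h => SplitExtension.baseChange_isom g.unop h))
  map_id B := by
    ext E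
    induction E using Quotient.inductionOn with
    | _ E => exact Quotient.sound (SplitExtension.baseChange_id_isom E)
  map_comp g g' := by
    ext E
    induction E using Quotient.inductionOn with
    | _ E => exact Quotient.sound (SplitExtension.baseChange_comp_isom g.unop g'.unop E)

variable (C)

/-- Every object `X` has a weak representation of actions on it: an object `M` together with a
monomorphism of functors `SplExt(-, X) ⟶ hom(-, M)`.  (The hom-sets are lifted to the universe
in which `SplExt(-, X)` takes its values.) -/
def WeaklyActionRepresentable : Prop :=
  ∀ X : C, ∃ (M : C) (μ : splExtFunctor X ⟶ uliftYoneda.{u}.obj M), Mono μ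

end Representability

variable (C)

/-- Every split extension `E` with kernel `X` admits a morphism `(f, g, 1_X) : E ⟶ E'` into a
faithful split extension `E'` with the same kernel `X`. -/
def ActionAccessible : Prop :=
  ∀ (X B : C) (E : SplitExtension B X), ∃ (B' : C) (E' : SplitExtension B' X)
    (φ : SplitExtension.Hom E E'), φ.h = 𝟙 X ∧ E'.IsFaithful

/-- A semi-abelian category: pointed, with finite coproducts, Barr exact (regular, and every
internal equivalence relation is a kernel pair) and Bourn protomodular (in the pointed setting:
the split short five lemma holds). -/
class SemiAbelian : Prop extends Regular C where
  hasZeroObject : HasZeroObject C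
  hasFiniteCoproducts : HasFiniteCoproducts C
  exact : ∀ ⦃R A : C⦄ (p₁ p₂ : R ⟶ A), IsEquivalenceRelation p₁ p₂ →
    ∃ (Q : C) (π : A ⟶ Q), IsKernelPair π p₁ p₂
  protomodular : ∀ ⦃B X B' X' : C⦄ (E : SplitExtension B X) (E' : SplitExtension B' X')
    (φ : SplitExtension.Hom E E'), IsIso φ.g → IsIso φ.h → IsIso φ.f

end SplitExtensions

/-! ### Not necessarily unital algebras -/

/-- Associative, not necessarily unital algebras over a commutative ring `K`.  For `K = ℤ` these
are the not necessarily unital rings. -/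
structure NonUnitalAlgCat (K : Type w) [CommRing K] where
  carrier : Type v
  [isNonUnitalRing : NonUnitalRing carrier]
  [isModule : Module K carrier]
  [isScalarTower : IsScalarTower K carrier carrier]
  [smulCommClass : SMulCommClass K carrier carrier]

namespace NonUnitalAlgCat

variable {K : Type w} [CommRing K]

instance : CoeSort (NonUnitalAlgCat.{w, v} K) (Type v) := ⟨NonUnitalAlgCat.carrier⟩

attribute [instance] isNonUnitalRing isModule isScalarTower smulCommClass

/-- Morphisms are the multiplicative `K`-linear maps. -/
@[ext]
structure Hom (A B : NonUnitalAlgCat.{w, v} K) where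
  hom : A →ₙₐ[K] B

instance : Category (NonUnitalAlgCat.{w, v} K) where
  Hom A B := Hom A B
  id A := ⟨NonUnitalAlgHom.id K A⟩
  comp f g := ⟨g.hom.comp f.hom⟩

theorem hom_ext {A B : NonUnitalAlgCat.{w, v} K} {f g : A ⟶ B} (h : ∀ a, f.hom a = g.hom a) :
    f = g :=
  Hom.ext (NonUnitalAlgHom.ext h)

instance : HasZeroMorphisms (NonUnitalAlgCat.{w, v} K) where
  zero _ _ := ⟨⟨0⟩⟩
  comp_zero _ _ := rfl
  zero_comp _ _ _ g := hom_ext fun _ => map_zero g.hom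

instance : HasPullbacks (NonUnitalAlgCat.{w, v} K) := by
  have key : ∀ {A B D : NonUnitalAlgCat.{w, v} K} (f : A ⟶ D) (g : B ⟶ D),
      HasLimit (cospan f g) := by
    intro A B D f g
    let S : NonUnitalSubalgebra K (A × B) := NonUnitalAlgHom.equalizer
      (f.hom.comp (NonUnitalAlgHom.fst K A B)) (g.hom.comp (NonUnitalAlgHom.snd K A B))
    let P : NonUnitalAlgCat.{w, v} K := ⟨S⟩
    let p : P ⟶ A := ⟨(NonUnitalAlgHom.fst K A B).comp (NonUnitalSubalgebraClass.subtype S)⟩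
    let q : P ⟶ B := ⟨(NonUnitalAlgHom.snd K A B).comp (NonUnitalSubalgebraClass.subtype S)⟩
    have w : p ≫ f = q ≫ g := hom_ext fun a => a.2
    refine ⟨⟨⟨PullbackCone.mk p q w, PullbackCone.IsLimit.mk w
      (fun s => ⟨NonUnitalAlgHom.codRestrict (s.fst.hom.prod s.snd.hom) S
        (fun a => show f.hom (s.fst.hom a) = g.hom (s.snd.hom a) from
          congrArg (fun k : s.pt ⟶ D => k.hom a) s.condition)⟩) (fun s => rfl) (fun s => rfl) ?_⟩⟩⟩
    intro s m h1 h2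
    refine hom_ext fun a => Subtype.ext (Prod.ext ?_ ?_)
    · exact congrArg (fun k => k.hom a) h1
    · exact congrArg (fun k => k.hom a) h2
  exact hasPullbacks_of_hasLimit_cospan _

end NonUnitalAlgCat

/-! A monomorphism `SplExt(-, X) ⟶ hom(-, M)` assigns to each split extension `E` of `B` a map `m E
: B ⟶ M`, natural under pullback and determining `E` up to isomorphism. If `m E` is a monomorphism
then `E` is faithful: the base component of any morphism `F ⟶ E` that is the identity on `X`
satisfies `g ≫ m E = m F`, and by protomodularity the base component determines the morphism. In
general, factor `m E` as a regular epimorphism `q : B ⟶ I` followed by a monomorphism `i`. The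
pullbacks of `E` along the two projections of the kernel pair of `q` have equal classifying maps,
hence are isomorphic, which gives descent data for `E` along `q`. No cocycle condition has to be
checked, since base components determine morphisms. Exactness then yields a descended extension `E'`
of `I` (`exists_descent`); cancelling `q` gives `m E' = i`, so `E'` is faithful. For algebras both
claims are proved directly. The left and right actions of `B` on `X` determine `E`
(`action_eq_iff`), so pairs of linear operators on `X` serve as `M`. The image `T` of the action
satisfies the laws of a bimultiplication, and the semidirect product of `T` with `X` is faithful
because its action is an inclusion. -/

namespace SplitExtension

/-! ### Kernels and morphisms of split extensions -/

section General

variable {C : Type u} [Category.{v} C] [HasZeroMorphisms C]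

/-- The universal property of the kernel inclusion of a split extension. -/
theorem exists_lift_κ {B X : C} (E : SplitExtension B X) {W : C} (k : W ⟶ E.A)
    (hk : k ≫ E.α = 0) : ∃ l : W ⟶ X, l ≫ E.κ = k := by
  obtain ⟨hE⟩ := E.isKernel
  exact ⟨hE.lift (KernelFork.ofι k hk), hE.fac (KernelFork.ofι k hk) WalkingParallelPair.zero⟩

instance mono_κ {B X : C} (E : SplitExtension B X) : Mono E.κ := by
  obtain ⟨hE⟩ := E.isKernel
  exact ⟨fun _ _ h => Fork.IsLimit.hom_ext hE h⟩

theorem isKernel_of_exists_lift {A B X : C} (α : A ⟶ B) (κ : X ⟶ A) (hκ : κ ≫ α = 0) [Mono κ]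
    (h : ∀ {W : C} (k : W ⟶ A), k ≫ α = 0 → ∃ l : W ⟶ X, l ≫ κ = k) :
    Nonempty (IsLimit (KernelFork.ofι κ hκ)) :=
  ⟨KernelFork.IsLimit.ofι κ hκ (fun k hk => (h k hk).choose) (fun k hk => (h k hk).choose_spec)
    fun k hk _ hm => (cancel_mono κ).1 (hm.trans (h k hk).choose_spec.symm)⟩

/-- The projection from a pullback as a morphism of split extensions. -/
@[simps]
noncomputable def baseChangeHom [HasPullbacks C] {B B' X : C} (g : B' ⟶ B)
    (E : SplitExtension B X) : Hom (baseChange g E) E where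
  f := baseChangeFst g E
  g := g
  h := 𝟙 X
  comm_κ := by rw [baseChange_κ_fst, Category.id_comp]
  comm_α := (baseChange_isPullback g E).w
  comm_β := baseChange_β_fst g E

/-- Composition of morphisms of split extensions. -/
@[simps]
def Hom.comp {B X B' X' B'' X'' : C} {E : SplitExtension B X} {E' : SplitExtension B' X'}
    {E'' : SplitExtension B'' X''} (φ : Hom E E') (ψ : Hom E' E'') : Hom E E'' where
  f := φ.f ≫ ψ.f
  g := φ.g ≫ ψ.g
  h := φ.h ≫ ψ.h
  comm_κ := by rw [← Category.assoc, φ.comm_κ, Category.assoc, ψ.comm_κ, Category.assoc]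
  comm_α := by rw [Category.assoc, ψ.comm_α, ← Category.assoc, φ.comm_α, Category.assoc]
  comm_β := by rw [← Category.assoc, φ.comm_β, Category.assoc, ψ.comm_β, Category.assoc]

end General

/-! ### Weak representations as classifying maps -/

section WeakRepresentation

variable {C : Type u} [Category.{v} C] [HasZeroMorphisms C] [HasPullbacks C]

/-- A monomorphism `SplExt(-, X) ⟶ hom(-, M)`, expressed on split extensions. -/
structure Classifier (X M : C) where
  map : ∀ {B : C}, SplitExtension B X → (B ⟶ M)
  map_eq_iff : ∀ {B : C} (E E' : SplitExtension B X), map E = map E' ↔ Isom E E'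
  map_baseChange : ∀ {B B' : C} (g : B' ⟶ B) (E : SplitExtension B X),
    map (baseChange g E) = g ≫ map E

theorem exists_classifier {X M : C} (μ : splExtFunctor X ⟶ uliftYoneda.{u}.obj M) [Mono μ] :
    Nonempty (Classifier X M) := by
  have hinj : ∀ B : C, Function.Injective (μ.app (Opposite.op B)) := fun B =>
    (mono_iff_injective _).1 inferInstance
  refine ⟨⟨fun {B} E => (μ.app (Opposite.op B) (Quotient.mk _ E : SplExt B X)).down, ?_, ?_⟩⟩
  · intro B E E'
    exact ⟨fun h => Quotient.exact (hinj B (ULift.ext _ _ h)),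
      fun h => congrArg (fun e => (μ.app (Opposite.op B) e).down)
        (Quotient.sound h : (Quotient.mk _ E : SplExt B X) = Quotient.mk _ E')⟩
  · intro B B' g E
    exact congrArg ULift.down
      (ConcreteCategory.congr_hom (μ.naturality g.op) (Quotient.mk _ E : SplExt B X))

theorem Classifier.exists_mono {X M : C} (m : Classifier X M) :
    ∃ μ : splExtFunctor X ⟶ uliftYoneda.{u}.obj M, Mono μ := by
  refine ⟨{ app := fun B => ↾(fun e : SplExt B.unop X => ULift.up
              (Quotient.lift m.map (fun E E' h => (m.map_eq_iff E E').2 h) e))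
            naturality := ?_ }, ?_⟩
  · intro B B' g
    ext e
    induction e using Quotient.inductionOn with
    | _ E => exact congrArg ULift.up (m.map_baseChange g.unop E)
  · rw [NatTrans.mono_iff_mono_app]
    intro B
    rw [mono_iff_injective]
    intro e e' h
    induction e using Quotient.inductionOn with
    | _ E =>
      induction e' using Quotient.inductionOn with
      | _ E' => exact Quotient.sound ((m.map_eq_iff E E').1 (congrArg ULift.down h))

end WeakRepresentation

/-! ### Consequences of protomodularity -/

section Protomodular

variable {C : Type u} [Category.{v} C] [HasZeroMorphisms C] [SemiAbelian C]

/-- The section and the kernel inclusion of a split extension are jointly epimorphic. -/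
theorem hom_ext_of_κ_β {B X Z : C} (E : SplitExtension B X) {f g : E.A ⟶ Z}
    (hκ : E.κ ≫ f = E.κ ≫ g) (hβ : E.β ≫ f = E.β ≫ g) : f = g := by
  let k : X ⟶ equalizer f g := equalizer.lift E.κ hκ
  have hk : k ≫ equalizer.ι f g = E.κ := equalizer.lift_ι _ _
  have : Mono k := mono_of_mono_fac hk
  -- Both `E.κ` and `E.β` factor through the equalizer, so it is itself a split extension of `B`
  -- with kernel `X`; protomodularity makes its inclusion into `E.A` invertible.
  let F : SplitExtension B X :=
    { A := equalizer f g
      α := equalizer.ι f g ≫ E.α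
      β := equalizer.lift E.β hβ
      κ := k
      section_proj := by rw [equalizer.lift_ι_assoc, E.section_proj]
      incl_proj := by rw [reassoc_of% hk, E.incl_proj]
      isKernel := isKernel_of_exists_lift _ _ _ fun w hw => by
        obtain ⟨l, hl⟩ := E.exists_lift_κ (w ≫ equalizer.ι f g) (by rw [Category.assoc, hw])
        exact ⟨l, equalizer.hom_ext (by rw [Category.assoc, hk, hl])⟩ }
  let φ : Hom F E :=
    { f := equalizer.ι f g
      g := 𝟙 B
      h := 𝟙 X
      comm_κ := by rw [hk, Category.id_comp]
      comm_α := (Category.comp_id _).symm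
      comm_β := by rw [equalizer.lift_ι, Category.id_comp] }
  have : IsIso (equalizer.ι f g) :=
    SemiAbelian.protomodular F E φ (inferInstanceAs (IsIso (𝟙 B))) (inferInstanceAs (IsIso (𝟙 X)))
  exact (cancel_epi (equalizer.ι f g)).1 (equalizer.condition f g)

variable {B B' X : C} {E : SplitExtension B X} {E' : SplitExtension B' X}

theorem Hom.isom_of_g_eq_id {E E' : SplitExtension B X} (φ : Hom E E') (hg : φ.g = 𝟙 B)
    (hh : φ.h = 𝟙 X) : Isom E E' :=
  ⟨φ, hg, hh, SemiAbelian.protomodular E E' φ (hg ▸ inferInstance) (hh ▸ inferInstance)⟩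

/-- Two morphisms of split extensions that agree on the quotient and the kernel are equal. -/
theorem Hom.ext_of_g {φ ψ : Hom E E'} (hg : φ.g = ψ.g) (hh : φ.h = ψ.h) : φ = ψ :=
  Hom.ext (E.hom_ext_of_κ_β (by rw [φ.comm_κ, ψ.comm_κ, hh]) (by rw [φ.comm_β, ψ.comm_β, hg])) hg hh

/-- A morphism that is the identity on the kernel identifies its source with a pullback of
its target. -/
theorem Hom.isom_baseChange (φ : Hom E E') (hh : φ.h = 𝟙 X) : Isom E (baseChange φ.g E') := by
  have hp := baseChange_isPullback φ.g E'
  refine Hom.isom_of_g_eq_id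
    { f := hp.lift φ.f E.α φ.comm_α
      g := 𝟙 B
      h := 𝟙 X
      comm_κ := hp.hom_ext ?_ ?_
      comm_α := by simp
      comm_β := hp.hom_ext ?_ ?_ } rfl rfl
  · simp [φ.comm_κ, hh, baseChange_κ_fst]
  · simp [E.incl_proj, (baseChange φ.g E').incl_proj]
  · simp [φ.comm_β, baseChange_β_fst]
  · simp [E.section_proj, (baseChange φ.g E').section_proj]

/-- A morphism that is the identity on the kernel is cartesian. -/
theorem Hom.isPullback (φ : Hom E E') (hh : φ.h = 𝟙 X) : IsPullback φ.f E.α E'.α φ.g := by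
  obtain ⟨ψ, hg, hψ, _⟩ := φ.isom_baseChange hh
  -- `Isom` does not record how `ψ` relates to `φ`; agreement on base and kernel recovers it.
  have h1 : φ = ψ.comp (baseChangeHom φ.g E') :=
    Hom.ext_of_g (by simp [hg]) (by simp [hh, hψ])
  have hf : φ.f = ψ.f ≫ baseChangeFst φ.g E' := congrArg Hom.f h1
  have h2 : IsPullback ψ.f E.α (baseChange φ.g E').α (𝟙 B) :=
    IsPullback.of_horiz_isIso ⟨by rw [ψ.comm_α, hg]⟩
  rw [hf]
  simpa using (h2.flip.paste_vert (baseChange_isPullback φ.g E').flip).flip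

/-- A split extension whose classifying morphism is a monomorphism is faithful. -/
theorem Classifier.isFaithful {M : C} (m : Classifier X M) [Mono (m.map E)] : E.IsFaithful := by
  intro B'' F φ ψ hφ hψ
  have key : ∀ χ : Hom F E, χ.h = 𝟙 X → χ.g ≫ m.map E = m.map F := fun χ hχ => by
    rw [← m.map_baseChange, eq_comm, m.map_eq_iff]
    exact χ.isom_baseChange hχ
  exact Hom.ext_of_g ((cancel_mono (m.map E)).1 ((key φ hφ).trans (key ψ hψ).symm))
    (hφ.trans hψ.symm)

end Protomodular

end SplitExtension

namespace SplitExtension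

/-! ### Descent along regular epimorphisms -/

section Descent

variable {C : Type u} [Category.{v} C] [HasZeroMorphisms C]

/-- The identity morphism of a split extension. -/
@[simps]
def Hom.id {B X : C} (E : SplitExtension B X) : Hom E E where
  f := 𝟙 _
  g := 𝟙 _
  h := 𝟙 _
  comm_κ := by simp
  comm_α := by simp
  comm_β := by simp

variable [SemiAbelian C]

/-- Morphisms that are the identity on the kernel factor through each other as soon as their
components on the quotients do. -/
theorem Hom.exists_lift {B B' B'' X : C} {E : SplitExtension B X} {F : SplitExtension B' X}
    {G : SplitExtension B'' X} (φ : Hom F E) (hφ : φ.h = 𝟙 X) (χ : Hom G E) (hχ : χ.h = 𝟙 X)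
    (d : B'' ⟶ B') (hd : d ≫ φ.g = χ.g) :
    ∃ ψ : Hom G F, ψ.g = d ∧ ψ.h = 𝟙 X ∧ ψ.f ≫ φ.f = χ.f := by
  have hp := φ.isPullback hφ
  refine ⟨{ f := hp.lift χ.f (G.α ≫ d) (by rw [χ.comm_α, Category.assoc, hd])
            g := d
            h := 𝟙 X
            comm_κ := hp.hom_ext ?_ ?_
            comm_α := hp.lift_snd _ _ _
            comm_β := hp.hom_ext ?_ ?_ }, rfl, rfl, hp.lift_fst _ _ _⟩
  · simp [χ.comm_κ, φ.comm_κ, hφ, hχ]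
  · simp [reassoc_of% G.incl_proj, F.incl_proj]
  · simp [χ.comm_β, φ.comm_β, reassoc_of% hd]
  · simp [reassoc_of% G.section_proj, F.section_proj]

variable {B I R X : C} {E : SplitExtension B X} {F : SplitExtension R X} {q : B ⟶ I}
  {φ₁ φ₂ : Hom F E}

/-- Descent data for a split extension along a kernel pair form an internal equivalence relation
on the total object. -/
theorem isEquivalenceRelation_of_isKernelPair (hR : IsKernelPair q φ₁.g φ₂.g)
    (h₁ : φ₁.h = 𝟙 X) (h₂ : φ₂.h = 𝟙 X) : IsEquivalenceRelation φ₁.f φ₂.f := by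
  have hp := φ₁.isPullback h₁
  have jm : ∀ ⦃Y : C⦄ (f g : Y ⟶ F.A), f ≫ φ₁.f = g ≫ φ₁.f → f ≫ φ₂.f = g ≫ φ₂.f → f = g :=
    fun Y f g h h' => hp.hom_ext h (hR.hom_ext
      (by rw [Category.assoc, Category.assoc, ← φ₁.comm_α, reassoc_of% h])
      (by rw [Category.assoc, Category.assoc, ← φ₂.comm_α, reassoc_of% h']))
  -- Each structure map is lifted through the cartesian `φ₁` from the corresponding map of the
  -- kernel pair. The law involving `φ₁` holds by construction; the one involving `φ₂` only needs
  -- comparing on the base.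
  obtain ⟨ρ, hρg, hρh, hρ⟩ := φ₁.exists_lift h₁ (Hom.id E) rfl
    (hR.lift (𝟙 _) (𝟙 _) rfl) (hR.lift_fst _ _ _)
  have hρ' : ρ.f ≫ φ₂.f = 𝟙 _ := congrArg Hom.f (Hom.ext_of_g (φ := ρ.comp φ₂) (ψ := Hom.id E)
    (by simp [hρg]) (by simp [hρh, h₂]))
  obtain ⟨σ, hσg, hσh, hσ⟩ := φ₁.exists_lift h₁ φ₂ h₂
    (hR.lift φ₂.g φ₁.g hR.w.symm) (hR.lift_fst _ _ _)
  have hσ' : σ.f ≫ φ₂.f = φ₁.f := congrArg Hom.f (Hom.ext_of_g (φ := σ.comp φ₂) (ψ := φ₁)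
    (by simp [hσg]) (by simp [hσh, h₁, h₂]))
  -- Over the object of composable pairs in the base, `u₁` and `u₂` are the two members of a pair
  -- and `u₃` is their composite.
  let t₁ := pullback.fst φ₂.g φ₁.g
  let t₂ := pullback.snd φ₂.g φ₁.g
  have ht : t₁ ≫ φ₂.g = t₂ ≫ φ₁.g := pullback.condition
  let u₁ := baseChangeHom t₁ F
  have hu₁ : u₁.h = 𝟙 X := rfl
  obtain ⟨u₂, hu₂g, hu₂h, hu₂⟩ := φ₁.exists_lift h₁ (u₁.comp φ₂) (by simp [hu₁, h₂]) t₂ ht.symm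
  obtain ⟨u₃, hu₃g, hu₃h, hu₃⟩ := φ₁.exists_lift h₁ (u₁.comp φ₁) (by simp [hu₁, h₁])
    (hR.lift (t₁ ≫ φ₁.g) (t₂ ≫ φ₂.g)
      (by rw [Category.assoc, hR.w, reassoc_of% ht, hR.w, Category.assoc]))
    (hR.lift_fst _ _ _)
  have hu : u₃.f ≫ φ₂.f = u₂.f ≫ φ₂.f := congrArg Hom.f
    (Hom.ext_of_g (φ := u₃.comp φ₂) (ψ := u₂.comp φ₂) (by simp [hu₃g, hu₂g])
      (by simp [hu₃h, hu₂h]))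
  let a := pullback.fst φ₂.f φ₁.f
  let b := pullback.snd φ₂.f φ₁.f
  have hab : a ≫ φ₂.f = b ≫ φ₁.f := pullback.condition
  have hc : (a ≫ F.α) ≫ φ₂.g = (b ≫ F.α) ≫ φ₁.g := by
    rw [Category.assoc, Category.assoc, ← φ₁.comm_α, ← φ₂.comm_α, reassoc_of% hab]
  -- Composable pairs of total objects map to the total object over composable pairs of the base, so
  -- `u₃` can be evaluated on them.
  let z := (baseChange_isPullback t₁ F).lift a (pullback.lift (a ≫ F.α) (b ≫ F.α) hc)
    (pullback.lift_fst _ _ _).symm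
  have hz₁ : z ≫ u₁.f = a := IsPullback.lift_fst _ _ _ _
  have hz₂ : z ≫ u₂.f = b := by
    refine hp.hom_ext ?_ ?_
    · rw [Category.assoc, hu₂, Hom.comp_f, reassoc_of% hz₁, hab]
    · rw [Category.assoc, u₂.comm_α, hu₂g, ← Category.assoc, IsPullback.lift_snd,
        pullback.lift_snd]
  have hw₁ : (z ≫ u₃.f) ≫ φ₁.f = a ≫ φ₁.f := by
    rw [Category.assoc, hu₃, Hom.comp_f, reassoc_of% hz₁]
  have hw₂ : (z ≫ u₃.f) ≫ φ₂.f = b ≫ φ₂.f := by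
    rw [Category.assoc, hu, reassoc_of% hz₂]
  exact ⟨⟨{
    right_cancellation := jm
    r := ρ.f
    reflexivity₁ := hρ
    reflexivity₂ := hρ'
    s := σ.f
    symmetry₁ := hσ
    symmetry₂ := hσ'
    c := PullbackCone.mk a b hab
    isLimit := pullbackIsPullback _ _
    t := z ≫ u₃.f
    transitivity₁ := hw₁
    transitivity₂ := hw₂ }⟩⟩

/-- The quotients of an equivalence relation fibred over a kernel pair form a pullback square. -/
theorem isPullback_of_isKernelPair (hR : IsKernelPair q φ₁.g φ₂.g)
    (h₁ : φ₁.h = 𝟙 X) {Q : C} {π : E.A ⟶ Q} [IsRegularEpi π] (hπ : IsKernelPair π φ₁.f φ₂.f)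
    {α : Q ⟶ I} (hα : π ≫ α = E.α ≫ q) : IsPullback π E.α α q := by
  have hp := φ₁.isPullback h₁
  let c : E.A ⟶ pullback α q := pullback.lift π E.α hα
  have hc₁ : c ≫ pullback.fst α q = π := pullback.lift_fst _ _ _
  have hc₂ : c ≫ pullback.snd α q = E.α := pullback.lift_snd _ _ _
  have hφα : φ₂.f ≫ E.α = F.α ≫ φ₂.g := φ₂.comm_α
  -- Maps identified by `c` form a pair in the kernel pair of `π` lying over the diagonal of `R`;
  -- since `φ₁` is cartesian, that pair is itself diagonal.
  have hmono : Mono c := by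
    constructor
    intro W a b hab
    have hab₁ : a ≫ π = b ≫ π := by rw [← hc₁, reassoc_of% hab]
    have hab₂ : a ≫ E.α = b ≫ E.α := by rw [← hc₂, reassoc_of% hab]
    have key : hπ.lift a b hab₁ = hπ.lift a a rfl := by
      refine hp.hom_ext (by simp) (hR.hom_ext ?_ ?_)
      · rw [Category.assoc, Category.assoc, ← φ₁.comm_α]
        simp
      · rw [Category.assoc, Category.assoc, ← φ₂.comm_α]
        simp [hab₂]
    rw [← hπ.lift_snd a a rfl, ← key, hπ.lift_snd]
  -- This exhibits `φ₂.f ≫ c` as a base change of the regular epimorphism `π`, which makes `c` a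
  -- strong epimorphism.
  have hsq : IsPullback φ₁.f (φ₂.f ≫ c) π (pullback.fst α q) := by
    refine ⟨⟨by rw [Category.assoc, hc₁, hπ.w]⟩, ⟨PullbackCone.IsLimit.mk _
      (fun s => hp.lift s.fst
        (hR.lift (s.fst ≫ E.α) (s.snd ≫ pullback.snd α q) ?_) ?_) ?_ ?_ ?_⟩⟩
    · rw [Category.assoc, ← hα, reassoc_of% s.condition, pullback.condition, Category.assoc]
    · rw [hR.lift_fst]
    · intro s
      exact hp.lift_fst _ _ _
    · intro s
      apply pullback.hom_ext
      · simp only [Category.assoc, hc₁, ← hπ.w]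
        rw [← Category.assoc, hp.lift_fst, s.condition]
      · simp only [Category.assoc, hc₂, hφα]
        rw [← Category.assoc, hp.lift_snd, hR.lift_snd]
    · intro s m hm₁ hm₂
      refine hp.hom_ext (by rw [hm₁, hp.lift_fst]) (hR.hom_ext ?_ ?_)
      · rw [hp.lift_snd, hR.lift_fst, Category.assoc, ← φ₁.comm_α, reassoc_of% hm₁]
      · rw [hp.lift_snd, hR.lift_snd, Category.assoc, ← φ₂.comm_α, ← hm₂, Category.assoc,
          Category.assoc, hc₂]
  have hreg : IsRegularEpi (φ₂.f ≫ c) :=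
    Regular.regularEpiIsStableUnderBaseChange.of_isPullback hsq ‹IsRegularEpi π›
  have : StrongEpi c := strongEpi_of_strongEpi φ₂.f c
  have : IsIso c := isIso_of_mono_of_strongEpi c
  exact IsPullback.of_iso_pullback ⟨hα⟩ (asIso c) hc₁ hc₂

/-- Split extensions descend along regular epimorphisms. -/
theorem exists_descent [IsRegularEpi q] (hR : IsKernelPair q φ₁.g φ₂.g)
    (h₁ : φ₁.h = 𝟙 X) (h₂ : φ₂.h = 𝟙 X) :
    ∃ (E' : SplitExtension I X) (φ : Hom E E'), φ.g = q ∧ φ.h = 𝟙 X := by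
  obtain ⟨Q₀, π₀, hπ₀⟩ := SemiAbelian.exact φ₁.f φ₂.f (isEquivalenceRelation_of_isKernelPair hR h₁ h₂)
  -- Exactness gives a map with the right kernel pair that need not be a regular epimorphism; its
  -- image part is one and has the same kernel pair.
  obtain ⟨Q, π, m, hreg, hm, hfac⟩ : ∃ (Q : C) (π : E.A ⟶ Q) (m : Q ⟶ Q₀),
      IsRegularEpi π ∧ Mono m ∧ π ≫ m = π₀ :=
    ⟨_, (Regular.strongEpiMonoFactorisation π₀).e, (Regular.strongEpiMonoFactorisation π₀).m,
      inferInstance, inferInstance, (Regular.strongEpiMonoFactorisation π₀).fac⟩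
  have hπ : IsKernelPair π φ₁.f φ₂.f := by
    rw [← hfac] at hπ₀
    exact hπ₀.cancel_right_of_mono
  obtain ⟨α, hα⟩ := IsRegularEpi.exists_of_isKernelPair π hπ (E.α ≫ q)
    (by rw [reassoc_of% φ₁.comm_α, reassoc_of% φ₂.comm_α, hR.w])
  obtain ⟨β, hβ⟩ := IsRegularEpi.exists_of_isKernelPair q hR (E.β ≫ π)
    (by rw [← reassoc_of% φ₁.comm_β, ← reassoc_of% φ₂.comm_β, hπ.w])
  have hp := isPullback_of_isKernelPair hR h₁ hπ hα
  have hκ : (E.κ ≫ π) ≫ α = 0 := by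
    rw [Category.assoc, hα, reassoc_of% E.incl_proj, zero_comp]
  have : Mono (E.κ ≫ π) := ⟨fun x y h => (cancel_mono E.κ).1 (hp.hom_ext (by simpa using h)
    (by simp [E.incl_proj]))⟩
  refine ⟨{ A := Q
            α := α
            β := β
            κ := E.κ ≫ π
            section_proj := ?_
            incl_proj := hκ
            isKernel := isKernel_of_exists_lift _ _ _ fun k hk => ?_ },
    { f := π
      g := q
      h := 𝟙 X
      comm_κ := (Category.id_comp _).symm
      comm_α := hα
      comm_β := hβ.symm }, rfl, rfl⟩
  · rw [← cancel_epi q, reassoc_of% hβ, hα, reassoc_of% E.section_proj, Category.comp_id]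
  -- Since `E.A` is the pullback of `α` along `q`, a map killed by `α` lifts to one killed by `E.α`.
  · obtain ⟨l, hl⟩ := E.exists_lift_κ (hp.lift k 0 (by rw [hk, zero_comp])) (hp.lift_snd _ _ _)
    exact ⟨l, by rw [reassoc_of% hl, hp.lift_fst]⟩

/-- A split extension with a classifying morphism admits a morphism to a faithful one. -/
theorem Classifier.exists_faithful {M : C} (m : Classifier X M) (E : SplitExtension B X) :
    ∃ (B' : C) (E' : SplitExtension B' X) (φ : Hom E E'), φ.h = 𝟙 X ∧ E'.IsFaithful := by
  obtain ⟨I, q, i, hq, hi, hfac⟩ : ∃ (I : C) (q : B ⟶ I) (i : I ⟶ M),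
      IsRegularEpi q ∧ Mono i ∧ q ≫ i = m.map E :=
    ⟨_, (Regular.strongEpiMonoFactorisation (m.map E)).e,
      (Regular.strongEpiMonoFactorisation (m.map E)).m,
      inferInstance, inferInstance, (Regular.strongEpiMonoFactorisation (m.map E)).fac⟩
  have hw : pullback.fst q q ≫ m.map E = pullback.snd q q ≫ m.map E := by
    rw [← hfac, pullback.condition_assoc]
  obtain ⟨ψ, hψg, hψh, _⟩ : Isom (baseChange (pullback.fst q q) E)
      (baseChange (pullback.snd q q) E) := by
    rw [← m.map_eq_iff, m.map_baseChange, m.map_baseChange, hw]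
  have hg : (ψ.comp (baseChangeHom (pullback.snd q q) E)).g = pullback.snd q q := by simp [hψg]
  obtain ⟨E', φ, hφg, hφh⟩ := exists_descent (q := q)
    (φ₁ := baseChangeHom (pullback.fst q q) E)
    (φ₂ := ψ.comp (baseChangeHom (pullback.snd q q) E))
    (by rw [hg]; exact IsKernelPair.of_hasPullback q) rfl (by simp [hψh])
  have hE' : m.map E' = i := by
    rw [← cancel_epi q, hfac, ← hφg, ← m.map_baseChange, eq_comm, m.map_eq_iff]
    exact φ.isom_baseChange hφh
  have : Mono (m.map E') := hE' ▸ hi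
  exact ⟨I, E', φ, hφh, m.isFaithful⟩

end Descent

end SplitExtension

theorem WeaklyActionRepresentable.actionAccessible {C : Type u} [Category.{v} C]
    [HasZeroMorphisms C] [SemiAbelian C] (h : WeaklyActionRepresentable C) :
    ActionAccessible C := fun X _ E => by
  obtain ⟨M, μ, _⟩ := h X
  obtain ⟨m⟩ := SplitExtension.exists_classifier μ
  exact m.exists_faithful E

namespace NonUnitalAlgCat

variable {K : Type w} [CommRing K]

/-! ### Algebras: element-level description of split extensions -/

section Elements

variable {B X : NonUnitalAlgCat.{w, v} K} (E : SplitExtension B X)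

theorem α_β_apply (b : B) : E.α.hom (E.β.hom b) = b :=
  congrArg (fun k : B ⟶ B => k.hom b) E.section_proj

theorem α_κ_apply (x : X) : E.α.hom (E.κ.hom x) = 0 :=
  congrArg (fun k : X ⟶ B => k.hom x) E.incl_proj

/-- The kernel of a homomorphism. -/
def kernel {A : NonUnitalAlgCat.{w, v} K} (f : A ⟶ B) : NonUnitalSubalgebra K A :=
  NonUnitalAlgHom.equalizer f.hom 0

/-- The inclusion of the kernel of a homomorphism. -/
def kernelι {A : NonUnitalAlgCat.{w, v} K} (f : A ⟶ B) :
    (⟨kernel f⟩ : NonUnitalAlgCat.{w, v} K) ⟶ A :=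
  ⟨NonUnitalSubalgebraClass.subtype (kernel f)⟩

theorem exists_κ_eq {a : E.A} (ha : E.α.hom a = 0) : ∃ x : X, E.κ.hom x = a := by
  obtain ⟨l, hl⟩ := E.exists_lift_κ (kernelι E.α) (hom_ext fun a => a.2)
  exact ⟨l.hom ⟨a, ha⟩, congrArg (fun k => k.hom (⟨a, ha⟩ : kernel E.α)) hl⟩

/-- The set-theoretic kernel also factors through `κ`, which gives a left inverse to the
corestriction of `κ`. -/
theorem κ_injective : Function.Injective E.κ.hom := by
  obtain ⟨l, hl⟩ := E.exists_lift_κ (kernelι E.α) (hom_ext fun a => a.2)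
  let k : X ⟶ (⟨kernel E.α⟩ : NonUnitalAlgCat.{w, v} K) :=
    ⟨NonUnitalAlgHom.codRestrict E.κ.hom (kernel E.α) (α_κ_apply E)⟩
  have hk : k ≫ l = 𝟙 X := by
    rw [← cancel_mono E.κ, Category.assoc, hl, Category.id_comp]
    rfl
  have hk' : ∀ x, l.hom (k.hom x) = x := fun x => congrArg (fun m : X ⟶ X => m.hom x) hk
  intro x y hxy
  rw [← hk' x, ← hk' y]
  exact congrArg l.hom (Subtype.ext hxy)

/-- The element `a - β (α a)` lies in the kernel. The retraction is only linear: on products, the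
actions enter. -/
theorem exists_retraction :
    ∃ p : E.A →ₗ[K] X, ∀ a, E.κ.hom (p a) = a - E.β.hom (E.α.hom a) := by
  have h : ∀ a : E.A, ∃ x : X, E.κ.hom x = a - E.β.hom (E.α.hom a) := fun a =>
    exists_κ_eq E (by rw [map_sub, α_β_apply, sub_self])
  choose p hp using h
  refine ⟨{ toFun := p, map_add' := fun a a' => κ_injective E ?_,
            map_smul' := fun c a => κ_injective E ?_ }, hp⟩
  · simp only [map_add, hp]
    abel
  · simp only [map_smul, hp, smul_sub, RingHom.id_apply]

/-- The linear retraction of the kernel inclusion of a split extension. -/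
noncomputable def retraction : E.A →ₗ[K] X := (exists_retraction E).choose

theorem κ_retraction (a : E.A) : E.κ.hom (retraction E a) = a - E.β.hom (E.α.hom a) :=
  (exists_retraction E).choose_spec a

theorem eq_β_add_κ (a : E.A) : a = E.β.hom (E.α.hom a) + E.κ.hom (retraction E a) := by
  rw [κ_retraction, add_sub_cancel]

theorem retraction_κ (x : X) : retraction E (E.κ.hom x) = x :=
  κ_injective E (by rw [κ_retraction, α_κ_apply, map_zero, sub_zero])

theorem retraction_β (b : B) : retraction E (E.β.hom b) = 0 :=
  κ_injective E (by rw [κ_retraction, α_β_apply, sub_self, map_zero])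

end Elements

/-- The algebra of pairs of linear operators on `X`, the first acting on the left and the second
on the right. -/
abbrev operators (X : NonUnitalAlgCat.{w, v} K) : NonUnitalAlgCat.{w, v} K :=
  ⟨Module.End K X × (Module.End K X)ᵐᵒᵖ⟩

/-! ### Algebras: classification by actions -/

section Action

variable {B X : NonUnitalAlgCat.{w, v} K} (E : SplitExtension B X)

/-- Left multiplication by an element of the quotient of a split extension on its kernel. -/
noncomputable def leftAct (b : B) : Module.End K X :=
  retraction E ∘ₗ LinearMap.mulLeft K (E.β.hom b) ∘ₗ (E.κ.hom : X →ₗ[K] E.A)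

/-- Right multiplication by an element of the quotient of a split extension on its kernel. -/
noncomputable def rightAct (b : B) : Module.End K X :=
  retraction E ∘ₗ LinearMap.mulRight K (E.β.hom b) ∘ₗ (E.κ.hom : X →ₗ[K] E.A)

/-- The image of `κ` is an ideal, so the retraction loses nothing on this product. -/
theorem κ_leftAct (b : B) (x : X) : E.κ.hom (leftAct E b x) = E.β.hom b * E.κ.hom x := by
  change E.κ.hom (retraction E (E.β.hom b * E.κ.hom x)) = _
  rw [κ_retraction, map_mul, α_κ_apply, mul_zero, map_zero, sub_zero]

theorem κ_rightAct (b : B) (x : X) : E.κ.hom (rightAct E b x) = E.κ.hom x * E.β.hom b := by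
  change E.κ.hom (retraction E (E.κ.hom x * E.β.hom b)) = _
  rw [κ_retraction, map_mul, α_κ_apply, zero_mul, map_zero, sub_zero]

/-- The action of the quotient of a split extension on its kernel. -/
noncomputable def action : B ⟶ operators X where
  hom :=
    { toFun := fun b => (leftAct E b, MulOpposite.op (rightAct E b))
      map_smul' := fun c b => Prod.ext
        (LinearMap.ext fun x => κ_injective E (by simp [κ_leftAct, smul_mul_assoc]))
        (MulOpposite.unop_injective
          (LinearMap.ext fun x => κ_injective E (by simp [κ_rightAct, mul_smul_comm])))
      map_zero' := Prod.ext
        (LinearMap.ext fun x => κ_injective E (by simp [κ_leftAct]))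
        (MulOpposite.unop_injective
          (LinearMap.ext fun x => κ_injective E (by simp [κ_rightAct])))
      map_add' := fun b c => Prod.ext
        (LinearMap.ext fun x => κ_injective E (by simp [κ_leftAct, add_mul]))
        (MulOpposite.unop_injective
          (LinearMap.ext fun x => κ_injective E (by simp [κ_rightAct, mul_add])))
      map_mul' := fun b c => Prod.ext
        (LinearMap.ext fun x => κ_injective E (by simp [κ_leftAct, mul_assoc]))
        (MulOpposite.unop_injective
          (LinearMap.ext fun x => κ_injective E (by simp [κ_rightAct, mul_assoc]))) }

theorem action_fst (b : B) : ((action E).hom b).1 = leftAct E b := rfl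

theorem action_snd (b : B) : ((action E).hom b).2 = MulOpposite.op (rightAct E b) := rfl

variable {E} {B' : NonUnitalAlgCat.{w, v} K} {E' : SplitExtension B' X}

theorem f_κ_apply (φ : E.Hom E') (hφ : φ.h = 𝟙 X) (x : X) :
    φ.f.hom (E.κ.hom x) = E'.κ.hom x := by
  have h := φ.comm_κ
  rw [hφ, Category.id_comp] at h
  exact congrArg (fun k : X ⟶ E'.A => k.hom x) h

theorem f_β_apply (φ : E.Hom E') (b : B) : φ.f.hom (E.β.hom b) = E'.β.hom (φ.g.hom b) :=
  congrArg (fun k : B ⟶ E'.A => k.hom b) φ.comm_β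

/-- Morphisms that are the identity on the kernel are compatible with the actions. -/
theorem comp_action (φ : E.Hom E') (hφ : φ.h = 𝟙 X) : φ.g ≫ action E' = action E := by
  refine hom_ext fun b => Prod.ext (LinearMap.ext fun x => κ_injective E' ?_)
    (MulOpposite.unop_injective (LinearMap.ext fun x => κ_injective E' ?_))
  · change E'.κ.hom (leftAct E' (φ.g.hom b) x) = E'.κ.hom (leftAct E b x)
    rw [κ_leftAct, ← f_κ_apply φ hφ, ← f_κ_apply φ hφ, κ_leftAct, map_mul, f_β_apply]
  · change E'.κ.hom (rightAct E' (φ.g.hom b) x) = E'.κ.hom (rightAct E b x)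
    rw [κ_rightAct, ← f_κ_apply φ hφ, ← f_κ_apply φ hφ, κ_rightAct, map_mul, f_β_apply]

/-- A homomorphism out of a split extension is determined on the quotient and the kernel. -/
theorem hom_ext_of_κ_β {Z : NonUnitalAlgCat.{w, v} K} {f g : E.A ⟶ Z}
    (hκ : E.κ ≫ f = E.κ ≫ g) (hβ : E.β ≫ f = E.β ≫ g) : f = g := by
  refine hom_ext fun a => ?_
  rw [eq_β_add_κ E a, map_add, map_add]
  exact congrArg₂ (· + ·) (congrArg (fun k : B ⟶ Z => k.hom (E.α.hom a)) hβ)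
    (congrArg (fun k : X ⟶ Z => k.hom (retraction E a)) hκ)

theorem isFaithful_of_injective_action (h : Function.Injective (action E).hom) :
    E.IsFaithful := by
  intro B'' F φ ψ hφ hψ
  have hg : φ.g = ψ.g := hom_ext fun b => h (congrArg (fun k : B'' ⟶ operators X => k.hom b)
    ((comp_action φ hφ).trans (comp_action ψ hψ).symm))
  exact SplitExtension.Hom.ext (hom_ext_of_κ_β (by rw [φ.comm_κ, ψ.comm_κ, hφ, hψ])
    (by rw [φ.comm_β, ψ.comm_β, hg])) hg (hφ.trans hψ.symm)

/-- A homomorphism compatible with the actions extends to a morphism of split extensions. -/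
theorem exists_hom_of_comp_action (g : B ⟶ B') (hg : g ≫ action E' = action E) :
    ∃ φ : E.Hom E', φ.g = g ∧ φ.h = 𝟙 X := by
  have hl : ∀ b, leftAct E' (g.hom b) = leftAct E b := fun b =>
    congrArg (fun k : B ⟶ operators X => (k.hom b).1) hg
  have hr : ∀ b, rightAct E' (g.hom b) = rightAct E b := fun b =>
    congrArg (fun k : B ⟶ operators X => (k.hom b).2.unop) hg
  -- Forced by the decomposition `eq_β_add_κ`; the formula `hmul` below reduces multiplicativity to
  -- equality of the actions.
  let f : E.A → E'.A := fun a => E'.β.hom (g.hom (E.α.hom a)) + E'.κ.hom (retraction E a)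
  have hmul : ∀ a c, retraction E (a * c) = leftAct E (E.α.hom a) (retraction E c) +
      rightAct E (E.α.hom c) (retraction E a) + retraction E a * retraction E c := by
    intro a c
    apply κ_injective E
    simp only [map_add, map_mul, κ_leftAct, κ_rightAct, κ_retraction]
    noncomm_ring
  refine ⟨{ f := ⟨{ toFun := f, map_smul' := ?_, map_zero' := ?_, map_add' := ?_,
                    map_mul' := ?_ }⟩
            g := g
            h := 𝟙 X
            comm_κ := hom_ext fun x => ?_
            comm_α := hom_ext fun a => ?_
            comm_β := hom_ext fun b => ?_ }, rfl, rfl⟩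
  · intro c a
    simp [f]
  · simp [f]
  · intro a c
    simp only [f, map_add]
    abel
  · intro a c
    simp only [f, hmul, map_add, map_mul, ← hl, ← hr, κ_leftAct, κ_rightAct]
    noncomm_ring
  · change E'.β.hom (g.hom (E.α.hom (E.κ.hom x))) + E'.κ.hom (retraction E (E.κ.hom x)) =
      E'.κ.hom x
    rw [α_κ_apply, retraction_κ, map_zero, map_zero, zero_add]
  · change E'.α.hom (E'.β.hom (g.hom (E.α.hom a)) + E'.κ.hom (retraction E a)) =
      g.hom (E.α.hom a)
    rw [map_add, α_κ_apply, α_β_apply, add_zero]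
  · change E'.β.hom (g.hom (E.α.hom (E.β.hom b))) + E'.κ.hom (retraction E (E.β.hom b)) =
      E'.β.hom (g.hom b)
    rw [α_β_apply, retraction_β, map_zero, add_zero]

/-- Equal actions let the identity of `B` extend in both directions; the extensions are mutually
inverse because `κ` and `β` determine homomorphisms. -/
theorem action_eq_iff {E E' : SplitExtension B X} :
    action E = action E' ↔ SplitExtension.Isom E E' := by
  constructor
  · intro h
    obtain ⟨φ, hφg, hφh⟩ := exists_hom_of_comp_action (E := E) (E' := E') (𝟙 B)
      (by rw [h, Category.id_comp])
    obtain ⟨ψ, hψg, hψh⟩ := exists_hom_of_comp_action (E := E') (E' := E) (𝟙 B)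
      (by rw [h, Category.id_comp])
    refine ⟨φ, hφg, hφh, ψ.f, hom_ext_of_κ_β ?_ ?_, hom_ext_of_κ_β ?_ ?_⟩
    · rw [← Category.assoc, φ.comm_κ, hφh, Category.id_comp, ψ.comm_κ, hψh, Category.id_comp,
        Category.comp_id]
    · rw [← Category.assoc, φ.comm_β, hφg, Category.id_comp, ψ.comm_β, hψg, Category.id_comp,
        Category.comp_id]
    · rw [← Category.assoc, ψ.comm_κ, hψh, Category.id_comp, φ.comm_κ, hφh, Category.id_comp,
        Category.comp_id]
    · rw [← Category.assoc, ψ.comm_β, hψg, Category.id_comp, φ.comm_β, hφg, Category.id_comp,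
        Category.comp_id]
  · rintro ⟨φ, hφg, hφh, _⟩
    rw [← comp_action φ hφh, hφg, Category.id_comp]

/-- Split extensions of algebras are classified by their actions. -/
noncomputable def actionClassifier (X : NonUnitalAlgCat.{w, v} K) :
    SplitExtension.Classifier X (operators X) where
  map E := action E
  map_eq_iff _ _ := action_eq_iff
  map_baseChange g E := (comp_action (SplitExtension.baseChangeHom g E) rfl).symm

end Action

theorem weaklyActionRepresentable : WeaklyActionRepresentable (NonUnitalAlgCat.{w, v} K) :=
  fun X => ⟨operators X, (actionClassifier X).exists_mono⟩

/-! ### Algebras: faithful semidirect products -/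

section Semidirect

variable {X : NonUnitalAlgCat.{w, v} K}

/-- An algebra of pairs of operators on `X` that satisfy the associativity laws of left and right
multiplication by elements of an algebra containing `X` as an ideal. -/
structure IsBimultiplication (T : NonUnitalSubalgebra K (operators X)) : Prop where
  left_mul : ∀ t ∈ T, ∀ x y : X, t.1 (x * y) = t.1 x * y
  right_mul : ∀ t ∈ T, ∀ x y : X, t.2.unop (x * y) = x * t.2.unop y
  mul_left : ∀ t ∈ T, ∀ x y : X, x * t.1 y = t.2.unop x * y
  left_right : ∀ s ∈ T, ∀ t ∈ T, ∀ x : X, s.1 (t.2.unop x) = t.2.unop (s.1 x)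

/-- Each law is associativity in `E.A`, read back through the injective `κ`. -/
theorem isBimultiplication_range {B : NonUnitalAlgCat.{w, v} K} (E : SplitExtension B X) :
    IsBimultiplication (NonUnitalAlgHom.range (action E).hom) where
  left_mul := by
    rintro _ ⟨b, rfl⟩ x y
    apply κ_injective E
    change E.κ.hom (leftAct E b (x * y)) = E.κ.hom (leftAct E b x * y)
    simp only [map_mul, κ_leftAct, mul_assoc]
  right_mul := by
    rintro _ ⟨b, rfl⟩ x y
    apply κ_injective E
    change E.κ.hom (rightAct E b (x * y)) = E.κ.hom (x * rightAct E b y)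
    simp only [map_mul, κ_rightAct, mul_assoc]
  mul_left := by
    rintro _ ⟨b, rfl⟩ x y
    apply κ_injective E
    change E.κ.hom (x * leftAct E b y) = E.κ.hom (rightAct E b x * y)
    simp only [map_mul, κ_leftAct, κ_rightAct, mul_assoc]
  left_right := by
    rintro _ ⟨b, rfl⟩ _ ⟨c, rfl⟩ x
    apply κ_injective E
    change E.κ.hom (leftAct E b (rightAct E c x)) =
      E.κ.hom (rightAct E c (leftAct E b x))
    simp only [κ_leftAct, κ_rightAct, mul_assoc]

/-- The underlying module of the semidirect product of an algebra of operators on `X` with `X`. -/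
def Semidirect {T : NonUnitalSubalgebra K (operators X)} (_ : IsBimultiplication T) : Type v :=
  T × X

namespace Semidirect

variable {T : NonUnitalSubalgebra K (operators X)} (hT : IsBimultiplication T)

noncomputable instance : AddCommGroup (Semidirect hT) := inferInstanceAs (AddCommGroup (T × X))

noncomputable instance : Module K (Semidirect hT) := inferInstanceAs (Module K (T × X))

/-- The second component copies the kernel part of a product in a split extension; the type synonym
keeps this apart from the componentwise product. -/
noncomputable instance : Mul (Semidirect hT) :=
  ⟨fun a b => (a.1 * b.1, a.1.1.1 b.2 + b.1.1.2.unop a.2 + a.2 * b.2)⟩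

/-- The element of a semidirect product with the given components. -/
def mk (t : T) (x : X) : Semidirect hT := (t, x)

variable {hT}

theorem fst_mk (t : T) (x : X) : (mk hT t x).1 = t := rfl
theorem snd_mk (t : T) (x : X) : (mk hT t x).2 = x := rfl

@[ext]
theorem ext {a b : Semidirect hT} (h₁ : a.1 = b.1) (h₂ : a.2 = b.2) : a = b := Prod.ext h₁ h₂

theorem fst_mul (a b : Semidirect hT) : (a * b).1 = a.1 * b.1 := rfl
theorem snd_mul (a b : Semidirect hT) :
    (a * b).2 = a.1.1.1 b.2 + b.1.1.2.unop a.2 + a.2 * b.2 := rfl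
theorem fst_add (a b : Semidirect hT) : (a + b).1 = a.1 + b.1 := rfl
theorem snd_add (a b : Semidirect hT) : (a + b).2 = a.2 + b.2 := rfl
theorem fst_zero : (0 : Semidirect hT).1 = 0 := rfl
theorem snd_zero : (0 : Semidirect hT).2 = 0 := rfl
theorem fst_smul (c : K) (a : Semidirect hT) : (c • a).1 = c • a.1 := rfl
theorem snd_smul (c : K) (a : Semidirect hT) : (c • a).2 = c • a.2 := rfl

variable (hT)

noncomputable instance : NonUnitalRing (Semidirect hT) where
  left_distrib a b c := by
    ext1
    · simp only [fst_mul, fst_add, mul_add]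
    · simp only [snd_mul, snd_add, fst_add, mul_add, map_add, NonUnitalSubalgebra.coe_add,
        Prod.snd_add, MulOpposite.unop_add, LinearMap.add_apply]
      abel
  right_distrib a b c := by
    ext1
    · simp only [fst_mul, fst_add, add_mul]
    · simp only [snd_mul, snd_add, fst_add, add_mul, map_add, NonUnitalSubalgebra.coe_add,
        Prod.fst_add, LinearMap.add_apply]
      abel
  zero_mul a := by
    ext1
    · simp only [fst_mul, fst_zero, zero_mul]
    · simp [snd_mul, snd_zero, fst_zero]
  mul_zero a := by
    ext1
    · simp only [fst_mul, fst_zero, mul_zero]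
    · simp [snd_mul, snd_zero, fst_zero]
  mul_assoc a b c := by
    ext1
    · simp only [fst_mul, mul_assoc]
    -- The four bimultiplication laws are what matches the mixed terms.
    · simp only [snd_mul, fst_mul, map_add, NonUnitalSubalgebra.coe_mul, Prod.fst_mul,
        Prod.snd_mul, MulOpposite.unop_mul, Module.End.mul_apply, add_mul, mul_add,
        hT.left_mul _ a.1.2, hT.right_mul _ c.1.2, hT.mul_left _ b.1.2,
        hT.left_right _ a.1.2 _ c.1.2, mul_assoc]
      abel

instance : IsScalarTower K (Semidirect hT) (Semidirect hT) := ⟨fun c a b => by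
  simp only [smul_eq_mul]
  ext1
  · simp only [fst_mul, fst_smul, smul_mul_assoc]
  · simp [snd_mul, snd_smul, fst_smul, smul_mul_assoc]⟩

instance : SMulCommClass K (Semidirect hT) (Semidirect hT) := ⟨fun c a b => by
  simp only [smul_eq_mul]
  ext1
  · simp only [fst_mul, fst_smul, mul_smul_comm]
  · simp [snd_mul, snd_smul, fst_smul, mul_smul_comm]⟩

/-- The inclusion of `X` in a semidirect product. -/
noncomputable def inr : X →ₙₐ[K] Semidirect hT where
  toFun x := mk hT 0 x
  map_smul' c x := by ext1 <;> simp [fst_smul, snd_smul, fst_mk, snd_mk]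
  map_zero' := rfl
  map_add' x y := by ext1 <;> simp [fst_add, snd_add, fst_mk, snd_mk]
  map_mul' x y := by ext1 <;> simp [fst_mul, snd_mul, fst_mk, snd_mk]

/-- The inclusion of the acting algebra in a semidirect product. -/
noncomputable def inl : T →ₙₐ[K] Semidirect hT where
  toFun t := mk hT t 0
  map_smul' c t := by ext1 <;> simp [fst_smul, snd_smul, fst_mk, snd_mk]
  map_zero' := rfl
  map_add' s t := by ext1 <;> simp [fst_add, snd_add, fst_mk, snd_mk]
  map_mul' s t := by ext1 <;> simp [fst_mul, snd_mul, fst_mk, snd_mk]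

/-- The projection of a semidirect product onto the acting algebra. -/
noncomputable def fst : Semidirect hT →ₙₐ[K] T where
  toFun a := a.1
  map_smul' _ _ := rfl
  map_zero' := rfl
  map_add' _ _ := rfl
  map_mul' _ _ := rfl

/-- The semidirect product as a split extension. -/
noncomputable def splitExtension :
    SplitExtension (⟨T⟩ : NonUnitalAlgCat.{w, v} K) X where
  A := ⟨Semidirect hT⟩
  α := ⟨fst hT⟩
  β := ⟨inl hT⟩
  κ := ⟨inr hT⟩
  section_proj := rfl
  incl_proj := rfl
  isKernel := by
    have : Mono (⟨inr hT⟩ : X ⟶ ⟨Semidirect hT⟩) := ⟨fun f g h => hom_ext fun x =>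
      congrArg (fun k => (k.hom x).2) h⟩
    refine SplitExtension.isKernel_of_exists_lift _ _ _ fun {W} k hk => ?_
    -- Once the first component vanishes, the second is multiplicative and provides the lift.
    have h0 : ∀ y, (k.hom y).1 = 0 := fun y => congrArg (fun m => m.hom y) hk
    refine ⟨⟨{ toFun := fun y => (k.hom y).2
               map_smul' := fun c y => ?_
               map_zero' := ?_
               map_add' := fun y z => ?_
               map_mul' := fun y z => ?_ }⟩, hom_ext fun y => ?_⟩
    · rw [map_smul]
      rfl
    · rw [map_zero]
      rfl
    · rw [map_add]
      rfl
    · rw [map_mul, snd_mul, h0, h0]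
      simp
    · exact Semidirect.ext (hT := hT) (h0 y).symm rfl

theorem action_splitExtension (t : T) : (action (splitExtension hT)).hom t = t.1 := by
  refine Prod.ext (LinearMap.ext fun x => κ_injective (splitExtension hT) ?_)
    (MulOpposite.unop_injective (LinearMap.ext fun x => κ_injective (splitExtension hT) ?_))
  · rw [action_fst, κ_leftAct]
    change mk hT t 0 * mk hT 0 x = mk hT 0 (t.1.1 x)
    ext1 <;> simp [fst_mul, snd_mul, fst_mk, snd_mk]
  · rw [action_snd, MulOpposite.unop_op, κ_rightAct]
    change mk hT 0 x * mk hT t 0 = mk hT 0 (t.1.2.unop x)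
    ext1 <;> simp [fst_mul, snd_mul, fst_mk, snd_mk]

end Semidirect

end Semidirect

theorem actionAccessible : ActionAccessible (NonUnitalAlgCat.{w, v} K) := by
  intro X B E
  have hT := isBimultiplication_range E
  -- The base component is the action corestricted to its image, on which the semidirect product
  -- acts by inclusion.
  obtain ⟨φ, -, hφ⟩ := exists_hom_of_comp_action (E := E) (E' := Semidirect.splitExtension hT)
    ⟨NonUnitalAlgHom.rangeRestrict (action E).hom⟩
    (hom_ext fun b => Semidirect.action_splitExtension hT _)
  refine ⟨_, Semidirect.splitExtension hT, φ, hφ, isFaithful_of_injective_action ?_⟩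
  intro s t h
  rw [Semidirect.action_splitExtension, Semidirect.action_splitExtension] at h
  exact Subtype.ext h

end NonUnitalAlgCat

theorem theorem4p6 :
    (∀ (C : Type u) [Category.{v} C] [HasZeroMorphisms C] [SemiAbelian C],
      WeaklyActionRepresentable C → ActionAccessible C) ∧
    (∀ (K : Type w) [CommRing K],
      WeaklyActionRepresentable (NonUnitalAlgCat.{w, v} K) ∧
        ActionAccessible (NonUnitalAlgCat.{w, v} K)) :=
  ⟨fun _ _ _ _ h => h.actionAccessible,
    fun _ _ => ⟨NonUnitalAlgCat.weaklyActionRepresentable, NonUnitalAlgCat.actionAccessible⟩⟩
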